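/- Let $L=\begin{pmatrix}1&0\\1&1\end{pmatrix}$ and $R=\begin{pmatrix}1&1\\0&1\end{pmatrix}$. Every $\{L,R\}$-word represents an element of $\mathrm{PSL}_2(\mathbb Z)$, every element of infinite order is conjugate to one represented by a non-empty word, and this word is unique up to cyclic permutation. The transpose ${}^tw$ of a word $w$ is obtained by reversing $w$ and exchanging $L$ and $R$. For a word $P$ and a non-empty word $w$, let $\mathrm{occ}_P(w)$ be the number of $0\le j<\mathrm{len}(w)$ such that $P$ is a prefix of the periodic sequence $www\cdots$ with its first $j$ letters removed. Define $\mathrm{mas}_P\colon \mathrm{PSL}_2(\mathbb Z)\to\mathbb Z$ by $\mathrm{mas}_P(A)=\mathrm{occ}_P(w)-\mathrm{occ}_{{}^tP}(w)$ if $A$ has infinite order and is conjugate to the element represented by the non-empty word $w$, and by $\mathrm{mas}_P(A)=0$ if $A$ has finite order. A homogeneous quasi-morphism on a group $\Pi$ is a function $f\colon\Pi\to\mathbb R$ such that $f(B)-f(AB)+f(A)$ is bounded over all $A,B\in\Pi$ and $f(A^n)=nf(A)$ for all $A\in\Pi$, $n\in\mathbb N$; these form a real vector space $PX(\Pi)$.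 Let $\mathcal P$ be the set of Lyndon words, namely the $\{L,R\}$-words which are strictly greater, in the lexicographic order extending $L<R$, than all their non-trivial cyclic permutations. Let $\mathcal P_0\subset\mathcal P$ be the subset of those which are a cyclic permutation of their transpose. For $P\in\mathcal P$ let $\tau(P)\in\mathcal P$ be the Lyndon word which is a cyclic permutation of ${}^tP$. Let $\mathcal P\setminus\mathcal P_0=\mathcal P_-\sqcup\mathcal P_+$ be any partition into two subsets such that $\tau$ maps $\mathcal P_+$ bijectively onto $\mathcal P_-$. Then the functions $\mathrm{mas}_P$, for $P\in\mathcal P_+$, are homogeneous quasi-morphisms on $\mathrm{PSL}_2(\mathbb Z)$ and are linearly independent in $PX(\mathrm{PSL}_2(\mathbb Z))$. Moreover, for each $A\in\mathrm{PSL}_2(\mathbb Z)$ only finitely many $P\in\mathcal P_+$ satisfy $\mathrm{mas}_P(A)\neq 0$, and for every $f\in PX(\mathrm{PSL}_2(\mathbb Z))$ there is a unique family $(m_P(f))_{P\in\mathcal P_+}\in\mathbb R^{\mathcal P_+}$ such that $f=\sum_{P\in\mathcal P_+}m_P(f)\,\mathrm{mas}_P$, that is, $f(A)=\sum_{P\in\mathcal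 P_+}m_P(f)\,\mathrm{mas}_P(A)$ for every $A\in\mathrm{PSL}_2(\mathbb Z)$. -/

import Mathlib

namespace ModularWord

/-- The modular group `PSL₂(ℤ)`. -/
abbrev PSLZ : Type := Matrix.ProjectiveSpecialLinearGroup (Fin 2) ℤ

/-- Words in the letters `L` (coded by `false`) and `R` (coded by `true`). The order `<` on words
is the lexicographic order extending `L < R`. -/
abbrev Word : Type := List Bool

/-- The matrices `L = (1 0; 1 1)` and `R = (1 1; 0 1)`. -/
def letter : Bool → Matrix.SpecialLinearGroup (Fin 2) ℤ
  | false => ⟨!![1, 0; 1, 1], by simp [Matrix.det_fin_two]⟩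
  | true => ⟨!![1, 1; 0, 1], by simp [Matrix.det_fin_two]⟩

/-- The element of `PSL₂(ℤ)` represented by a word. -/
def toPSL (w : Word) : PSLZ :=
  QuotientGroup.mk (w.map letter).prod

/-- Transposition of matrices, on words: reverse the word and exchange `L` and `R`. -/
def transpose (w : Word) : Word := (w.map not).reverse

/-- The letter number `n` (from `0`) of the periodic sequence `A^∞`, for a non-empty word `A`. -/
def periodic (A : Word) (n : ℕ) : Bool := A.getD (n % A.length) false

/-- The number of cyclic occurrences of the pattern `P` in the non-empty word `A`: the number of
shifts `σ^j A^∞`, with `j` in a full period, of which `P` is a prefix. -/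
def occ (P A : Word) : ℕ :=
  ((Finset.range A.length).filter
    fun j => ∀ i : Fin P.length, P.get i = periodic A (j + i)).card

open Classical in
/-- The `P`-asymmetry. If `A` is conjugate to the element represented by a non-empty word `w`
(that is, if `A` has infinite order; `w` is then unique up to cyclic permutation, and `occ P w`
depends on `w` only up to cyclic permutation), it is `occ P w - occ (transpose P) w`;
it is `0` on elements of finite order. -/
noncomputable def mas (P : Word) (A : PSLZ) : ℤ :=
  if h : ∃ w : Word, w ≠ [] ∧ IsConj (toPSL w) A then
    (occ P h.choose : ℤ) - (occ (transpose P) h.choose : ℤ)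
  else 0

/-- `mas P` as a real-valued function. -/
noncomputable def masReal (P : Word) : PSLZ → ℝ := fun A => (mas P A : ℝ)

/-- The real vector space of homogeneous quasi-morphisms on a group. -/
def PX (G : Type*) [Group G] : Submodule ℝ (G → ℝ) where
  carrier := {f | (∃ D : ℝ, ∀ A B : G, |f B - f (A * B) + f A| ≤ D) ∧
    ∀ (A : G) (n : ℕ), f (A ^ n) = n * f A}
  zero_mem' := ⟨⟨0, by simp⟩, by simp⟩
  add_mem' := by
    rintro f g ⟨⟨D, hD⟩, hf⟩ ⟨⟨E, hE⟩, hg⟩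
    refine ⟨⟨D + E, fun A B => ?_⟩, fun A n => ?_⟩
    · have h : (f + g) B - (f + g) (A * B) + (f + g) A
          = (f B - f (A * B) + f A) + (g B - g (A * B) + g A) := by
        simp only [Pi.add_apply]; ring
      rw [h]
      exact (abs_add_le _ _).trans (add_le_add (hD A B) (hE A B))
    · simp only [Pi.add_apply, hf, hg]; ring
  smul_mem' := by
    rintro c f ⟨⟨D, hD⟩, hf⟩
    refine ⟨⟨|c| * D, fun A B => ?_⟩, fun A n => ?_⟩
    · have h : (c • f) B - (c • f) (A * B) + (c • f) A = c * (f B - f (A * B) + f A) := by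
        simp only [Pi.smul_apply, smul_eq_mul]; ring
      rw [h, abs_mul]
      exact mul_le_mul_of_nonneg_left (hD A B) (abs_nonneg c)
    · simp only [Pi.smul_apply, smul_eq_mul, hf]; ring

/-- The Lyndon words: those strictly greater than all their non-trivial cyclic permutations. -/
def lyndonWords : Set Word :=
  {P | ∀ k : ℕ, 0 < k → k < P.length → P.rotate k < P}

/-- The Lyndon words that are cyclic permutations of their transpose; equivalently, those whose
conjugacy class in `PSL₂(ℤ)` is stable under inversion. -/
def symmetricLyndonWords : Set Word :=
  {P | P ∈ lyndonWords ∧ transpose P ~r P}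

/-- The greatest cyclic permutation of the transpose of `P`. For a Lyndon word `P`, it is the
Lyndon word that represents the transposed cyclic word. -/
def lyndonTranspose (P : Word) : Word :=
  (transpose P).cyclicPermutations.foldr max []

end ModularWord

/-!
The matrix `S = (0 -1; 1 0)` conjugates the inverse of a word to its transpose, and up to `S` on
both sides every element of `PSL₂(ℤ)` is given by exactly one word, its word of turns. In a product
an end of the first word of turns cancels against the beginning of the second, and then at most one
more pair of letters interacts. Occurrences of a pattern in a linear word are additive up to a
bounded error, so the difference of the occurrences of `P` and of its transpose in the word of turns
is a quasi-morphism on `PSL₂(ℤ)`, and `mas P` is its homogenization.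

A Lyndon word has no border, so it does not occur in the cyclic words that are shorter than it.
Hence the values of the `mas P` at the Lyndon words of a half system form a unitriangular matrix
for the order by length, and the coefficients of an expansion are found by recursion on length. The
expansion holds everywhere because a homogeneous quasi-morphism which vanishes on the half system is
zero: it is an odd class function, additive on commuting elements, and the greatest rotation of a
word, if it is not Lyndon, is a product of two shorter words that commute.
-/

namespace ModularWord

open Filter ModularGroup Topology

section CommutingAdditive

variable {G M : Type*} [Group G] [AddCommGroup M]

/-- Class functions which are additive on commuting pairs. This is the part of the notion of a
homogeneous quasi-morphism that survives infinite, pointwise finite sums. -/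
structure IsCommutingAdditive (f : G → M) : Prop where
  map_isConj : ∀ ⦃A B : G⦄, IsConj A B → f A = f B
  map_mul : ∀ ⦃A B : G⦄, Commute A B → f (A * B) = f A + f B

namespace IsCommutingAdditive

variable {f : G → M}

theorem map_one (hf : IsCommutingAdditive f) : f 1 = 0 := by
  simpa using hf.map_mul (Commute.one_left (1 : G))

theorem map_inv (hf : IsCommutingAdditive f) (A : G) : f A⁻¹ = -f A := by
  rw [eq_neg_iff_add_eq_zero, ← hf.map_mul (Commute.refl A).inv_left, inv_mul_cancel, hf.map_one]

theorem map_pow (hf : IsCommutingAdditive f) (A : G) (n : ℕ) : f (A ^ n) = n • f A := by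
  induction n with
  | zero => simp [hf.map_one]
  | succ n ih => rw [pow_succ, hf.map_mul ((Commute.refl A).pow_left n), ih, succ_nsmul]

theorem eq_zero_of_isOfFinOrder [IsAddTorsionFree M] (hf : IsCommutingAdditive f) {A : G}
    (hA : IsOfFinOrder A) : f A = 0 := by
  obtain ⟨n, hn, hpow⟩ := isOfFinOrder_iff_pow_eq_one.mp hA
  have h : n • f A = 0 := by rw [← hf.map_pow, hpow, hf.map_one]
  exact (smul_eq_zero_iff_right hn.ne').mp h

theorem sub {g : G → M} (hf : IsCommutingAdditive f) (hg : IsCommutingAdditive g) :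
    IsCommutingAdditive fun A => f A - g A where
  map_isConj A B h := by rw [hf.map_isConj h, hg.map_isConj h]
  map_mul A B h := by rw [hf.map_mul h, hg.map_mul h, add_sub_add_comm]

theorem smul_const {f : G → ℤ} (hf : IsCommutingAdditive f) (x : M) :
    IsCommutingAdditive fun A => f A • x where
  map_isConj A B h := by rw [hf.map_isConj h]
  map_mul A B h := by rw [hf.map_mul h, add_smul]

theorem finsum {ι : Type*} {f : ι → G → M} (hf : ∀ i, IsCommutingAdditive (f i))
    (hfin : ∀ A, (Function.support fun i => f i A).Finite) :
    IsCommutingAdditive fun A => ∑ᶠ i, f i A where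
  map_isConj A B h := finsum_congr fun i => (hf i).map_isConj h
  map_mul A B h := by
    rw [← finsum_add_distrib (hfin A) (hfin B)]
    exact finsum_congr fun i => (hf i).map_mul h

end IsCommutingAdditive

end CommutingAdditive

section Quasimorphism

variable {G : Type*} [Group G]

/-- The function `φ` is a quasi-morphism whose defect is at most `D`; no homogeneity is asked. -/
def HasDefectLE (φ : G → ℝ) (D : ℝ) : Prop :=
  ∀ A B : G, |φ B - φ (A * B) + φ A| ≤ D

theorem tendsto_div_of_abs_sub_mul_le {u : ℕ → ℝ} {x C : ℝ} (h : ∀ n : ℕ, |u n - n * x| ≤ C) :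
    Tendsto (fun n : ℕ => u n / n) atTop (𝓝 x) := by
  have herr : Tendsto (fun n : ℕ => (u n - n * x) / n) atTop (𝓝 0) :=
    tendsto_bdd_div_atTop_nhds_zero (b := -C) (B := C)
      (Eventually.of_forall fun n => (abs_le.mp (h n)).1)
      (Eventually.of_forall fun n => (abs_le.mp (h n)).2) tendsto_natCast_atTop_atTop
  have hsum := herr.add_const x
  rw [zero_add] at hsum
  refine hsum.congr' ?_
  filter_upwards [eventually_ne_atTop 0] with n hn
  have hn' : (n : ℝ) ≠ 0 := Nat.cast_ne_zero.mpr hn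
  field_simp
  ring

theorem tendsto_pow_div_of_isOfFinOrder (φ : G → ℝ) {A : G} (hA : IsOfFinOrder A) :
    Tendsto (fun n : ℕ => φ (A ^ n) / n) atTop (𝓝 0) := by
  obtain ⟨C, hC⟩ := (hA.finite_powers.image fun B => |φ B|).bddAbove
  refine tendsto_div_of_abs_sub_mul_le (C := C) fun n => ?_
  rw [mul_zero, sub_zero]
  exact hC ⟨A ^ n, ⟨n, rfl⟩, rfl⟩

namespace HasDefectLE

variable {φ : G → ℝ} {D : ℝ}

theorem abs_map_pow_sub_le (hφ : HasDefectLE φ D) (A : G) {n : ℕ} (hn : 1 ≤ n) :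
    |φ (A ^ n) - n * φ A| ≤ n * D := by
  have hD : 0 ≤ D := (abs_nonneg _).trans (hφ 1 1)
  induction n, hn using Nat.le_induction with
  | base => simpa using hD
  | succ n _ ih =>
    have h := hφ A (A ^ n)
    rw [← pow_succ'] at h
    push_cast
    rw [abs_le] at *
    constructor <;> linarith

theorem tendsto_pow_div_of_isConj (hφ : HasDefectLE φ D) {A B : G} (hAB : IsConj A B) {x : ℝ}
    (hA : Tendsto (fun n : ℕ => φ (A ^ n) / n) atTop (𝓝 x)) :
    Tendsto (fun n : ℕ => φ (B ^ n) / n) atTop (𝓝 x) := by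
  obtain ⟨c, rfl⟩ := isConj_iff.mp hAB
  have hdiff : Tendsto (fun n : ℕ => (φ ((c * A * c⁻¹) ^ n) - φ (A ^ n)) / n) atTop (𝓝 0) := by
    refine tendsto_div_of_abs_sub_mul_le (C := 2 * D + |φ c| + |φ c⁻¹|) fun n => ?_
    have hleft := abs_le.mp (hφ c (A ^ n * c⁻¹))
    have hright := abs_le.mp (hφ (A ^ n) c⁻¹)
    rw [conj_pow, mul_assoc, mul_zero, sub_zero, abs_le]
    constructor <;> linarith [neg_abs_le (φ c), le_abs_self (φ c), neg_abs_le (φ c⁻¹),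
      le_abs_self (φ c⁻¹)]
  simpa [← add_div] using hdiff.add hA

theorem abs_sub_le_of_tendsto (hφ : HasDefectLE φ D) {A : G} {x : ℝ}
    (hA : Tendsto (fun n : ℕ => φ (A ^ n) / n) atTop (𝓝 x)) : |x - φ A| ≤ D := by
  refine le_of_tendsto (hA.sub_const (φ A)).abs ?_
  filter_upwards [eventually_ge_atTop 1] with n hn
  have hn' : (0 : ℝ) < n := by exact_mod_cast hn
  have h : φ (A ^ n) / n - φ A = (φ (A ^ n) - n * φ A) / n := by field_simp
  rw [h, abs_div, abs_of_pos hn', div_le_iff₀ hn', mul_comm D]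
  exact hφ.abs_map_pow_sub_le A hn

theorem mem_PX_of_tendsto (hφ : HasDefectLE φ D) {f : G → ℝ}
    (hf : ∀ A, Tendsto (fun n : ℕ => φ (A ^ n) / n) atTop (𝓝 (f A))) : f ∈ PX G := by
  refine ⟨⟨4 * D, fun A B => ?_⟩, fun A k => ?_⟩
  · have hclose : ∀ A, |f A - φ A| ≤ D := fun A => hφ.abs_sub_le_of_tendsto (hf A)
    have h := hφ A B
    have hA := hclose A
    have hB := hclose B
    have hAB := hclose (A * B)
    rw [abs_le] at *
    constructor <;> linarith
  · refine tendsto_nhds_unique (hf (A ^ k)) ?_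
    obtain rfl | hk := Nat.eq_zero_or_pos k
    · simpa using tendsto_const_div_atTop_nhds_zero_nat (φ 1)
    · have hk' : (k : ℝ) ≠ 0 := Nat.cast_ne_zero.mpr hk.ne'
      refine (((hf A).comp (tendsto_id.const_mul_atTop' hk)).const_mul (k : ℝ)).congr fun n => ?_
      simp only [Function.comp_apply, id_eq, Nat.cast_mul, ← pow_mul]
      field_simp

end HasDefectLE

theorem IsCommutingAdditive.of_mem_PX {f : G → ℝ} (hf : f ∈ PX G) : IsCommutingAdditive f := by
  obtain ⟨⟨D, hdefect⟩, hpow⟩ := hf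
  have hlim : ∀ A, Tendsto (fun n : ℕ => f (A ^ n) / n) atTop (𝓝 (f A)) := fun A =>
    tendsto_div_of_abs_sub_mul_le (C := 0) fun n => by simp [hpow]
  refine ⟨fun A B hAB => tendsto_nhds_unique
    (HasDefectLE.tendsto_pow_div_of_isConj hdefect hAB (hlim A)) (hlim B), fun A B hAB => ?_⟩
  have hbdd : ∀ n : ℕ, |0 - n * (f B - f (A * B) + f A)| ≤ D := fun n => by
    have h := hdefect (A ^ n) (B ^ n)
    rwa [← hAB.mul_pow, hpow, hpow, hpow, ← mul_sub, ← mul_add, ← abs_neg, ← zero_sub] at h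
  have hzero : f B - f (A * B) + f A = 0 :=
    tendsto_nhds_unique (tendsto_div_of_abs_sub_mul_le hbdd) (by simp)
  linarith

end Quasimorphism

theorem existsUnique_finsum_smul_eq {ι R M : Type*} [Ring R] [AddCommGroup M] [Module R M]
    {r : ι → ι → Prop} (hr : WellFounded r) (hfin : ∀ j, {i | r i j}.Finite) {a : ι → ι → R}
    (hdiag : ∀ j, a j j = 1) (htri : ∀ i j, i ≠ j → ¬ r i j → a j i = 0) (b : ι → M) :
    ∃! m : ι → M, ∀ j, ∑ᶠ i, a j i • m i = b j := by
  have hsum : ∀ (m : ι → M) (j : ι),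
      ∑ᶠ i, a j i • m i = m j + ∑ i ∈ (hfin j).toFinset, a j i • m i := by
    classical
    intro m j
    have hj : j ∉ (hfin j).toFinset := by simpa using hr.irrefl.irrefl j
    rw [finsum_eq_sum_of_support_subset (s := insert j (hfin j).toFinset), Finset.sum_insert hj,
      hdiag, one_smul]
    intro i hi
    by_contra hmem
    simp only [Finset.coe_insert, Set.Finite.coe_toFinset, Set.mem_insert_iff, Set.mem_ofPred_eq,
      not_or] at hmem
    exact hi (by simp [htri i j hmem.1 hmem.2])
  let m : ι → M := hr.fix fun j m => b j -
    ∑ i ∈ (hfin j).toFinset.attach, a j i • m i ((hfin j).mem_toFinset.mp i.2)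
  have hm : ∀ j, m j = b j - ∑ i ∈ (hfin j).toFinset, a j i • m i := fun j => by
    rw [← Finset.sum_attach]
    exact hr.fix_eq _ j
  refine ⟨m, fun j => by rw [hsum, hm, sub_add_cancel], fun m' hm' => funext fun j => ?_⟩
  induction j using hr.induction with
  | _ j ih =>
    rw [hm, ← hm' j, hsum, eq_sub_iff_add_eq, add_right_inj]
    refine Finset.sum_congr rfl fun i hi => ?_
    rw [ih i ((hfin j).mem_toFinset.mp hi)]

section Words

@[simp]
theorem transpose_nil : transpose [] = [] := rfl

@[simp]
theorem transpose_append (v w : Word) : transpose (v ++ w) = transpose w ++ transpose v := by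
  simp [transpose]

@[simp]
theorem transpose_cons (a : Bool) (w : Word) : transpose (a :: w) = transpose w ++ [!a] := by
  simp [transpose]

@[simp]
theorem transpose_transpose (w : Word) : transpose (transpose w) = w := by
  simp [transpose, Function.comp_def]

@[simp]
theorem length_transpose (w : Word) : (transpose w).length = w.length := by
  simp [transpose]

end Words

theorem toPSL_nil : toPSL [] = 1 := rfl

theorem toPSL_append (v w : Word) : toPSL (v ++ w) = toPSL v * toPSL w := by
  simp only [toPSL, List.map_append, List.prod_append, QuotientGroup.mk_mul]

theorem toPSL_cons (a : Bool) (w : Word) : toPSL (a :: w) = toPSL [a] * toPSL w :=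
  toPSL_append [a] w

theorem mk_eq_mk_iff_eq_or_eq_neg {R : Type*} [CommRing R] [NoZeroDivisors R]
    {A B : Matrix.SpecialLinearGroup (Fin 2) R} :
    (QuotientGroup.mk A : Matrix.ProjectiveSpecialLinearGroup (Fin 2) R) = QuotientGroup.mk B ↔
      B = A ∨ B = -A := by
  rw [QuotientGroup.eq, Matrix.SpecialLinearGroup.mem_center_iff]
  constructor
  · rintro ⟨r, hr, hAB⟩
    rw [Fintype.card_fin, sq, mul_self_eq_one_iff] at hr
    rcases hr with rfl | rfl
    · have hone : A⁻¹ * B = 1 := Subtype.ext (by simp [← hAB])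
      exact .inl (inv_mul_eq_one.mp hone).symm
    · have hneg : A⁻¹ * B = -1 := Subtype.ext (by simp [← hAB, ← Matrix.diagonal_neg])
      exact .inr (by simpa [inv_mul_eq_iff_eq_mul] using hneg)
  · rintro (rfl | rfl)
    · exact ⟨1, by simp, by simp⟩
    · exact ⟨-1, by simp, by simp [← Matrix.diagonal_neg]⟩

/-- The involution of `PSL₂(ℤ)` represented by the matrix `S = (0 -1; 1 0)`. -/
def flip : PSLZ := QuotientGroup.mk S

theorem flip_mul_flip : flip * flip = 1 := by
  change (QuotientGroup.mk (S * S) : PSLZ) = QuotientGroup.mk 1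
  rw [mk_eq_mk_iff_eq_or_eq_neg]
  decide

theorem flip_inv : flip⁻¹ = flip := inv_eq_of_mul_eq_one_right flip_mul_flip

theorem toPSL_mul_flip_mul_toPSL_not (a : Bool) : toPSL [a] * flip * toPSL [!a] = flip := by
  change (QuotientGroup.mk (([a].map letter).prod * S * ([!a].map letter).prod) : PSLZ)
    = QuotientGroup.mk S
  rw [mk_eq_mk_iff_eq_or_eq_neg]
  cases a <;> decide

theorem toPSL_mul_flip_mul_toPSL_self (a : Bool) : toPSL [a] * flip * toPSL [a] = toPSL [!a] := by
  change (QuotientGroup.mk (([a].map letter).prod * S * ([a].map letter).prod) : PSLZ)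
    = QuotientGroup.mk ([!a].map letter).prod
  rw [mk_eq_mk_iff_eq_or_eq_neg]
  cases a <;> decide

theorem toPSL_mul_flip_mul_toPSL_transpose (w : Word) :
    toPSL w * flip * toPSL (transpose w) = flip := by
  induction w with
  | nil => simp [toPSL_nil]
  | cons a w ih =>
    rw [transpose_cons, toPSL_append, toPSL_cons]
    calc toPSL [a] * toPSL w * flip * (toPSL (transpose w) * toPSL [!a])
        = toPSL [a] * (toPSL w * flip * toPSL (transpose w)) * toPSL [!a] := by group
      _ = flip := by rw [ih, toPSL_mul_flip_mul_toPSL_not]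

theorem inv_toPSL (w : Word) : (toPSL w)⁻¹ = flip * toPSL (transpose w) * flip := by
  have h := toPSL_mul_flip_mul_toPSL_transpose w
  rw [mul_assoc, ← eq_inv_mul_iff_mul_eq] at h
  rw [h, mul_assoc, flip_mul_flip, mul_one]

theorem flip_mul_toPSL_singleton_pow_three (a : Bool) : (flip * toPSL [a]) ^ 3 = 1 := by
  have hnot := toPSL_mul_flip_mul_toPSL_not (!a)
  rw [Bool.not_not] at hnot
  calc (flip * toPSL [a]) ^ 3
      = flip * (toPSL [a] * flip * toPSL [a] * flip * toPSL [a]) := by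
        simp only [pow_succ, pow_zero, one_mul, mul_assoc]
    _ = 1 := by rw [toPSL_mul_flip_mul_toPSL_self, hnot, flip_mul_flip]

theorem entries_prod_map_letter (w : Word) :
    let M := (w.map letter).prod
    1 ≤ M 0 0 ∧ 0 ≤ M 0 1 ∧ 0 ≤ M 1 0 ∧ 1 ≤ M 1 1 ∧ (w.length : ℤ) ≤ M 0 1 + M 1 0 := by
  induction w with
  | nil => simp
  | cons a w ih =>
    have hmul : ∀ i j, ((a :: w).map letter).prod i j
        = letter a i 0 * (w.map letter).prod 0 j + letter a i 1 * (w.map letter).prod 1 j := by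
      intro i j
      rw [List.map_cons, List.prod_cons, Matrix.SpecialLinearGroup.coe_mul, Matrix.mul_apply,
        Fin.sum_univ_two]
    simp only [hmul, List.length_cons]
    cases a <;> simp [letter] <;> omega

/-- The subgroup of order two generated by `flip`. -/
abbrev flipGroup : Subgroup PSLZ := Subgroup.zpowers flip

theorem flip_mem_flipGroup : flip ∈ flipGroup := Subgroup.mem_zpowers flip

theorem mem_flipGroup_iff {g : PSLZ} : g ∈ flipGroup ↔ g = 1 ∨ g = flip := by
  refine ⟨?_, ?_⟩
  · rintro ⟨k, rfl⟩
    have hsq : flip ^ (2 : ℤ) = 1 := by rw [zpow_ofNat, sq, flip_mul_flip]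
    rcases Int.even_or_odd' k with ⟨m, rfl | rfl⟩
    · exact .inl (by simp [zpow_mul, hsq])
    · exact .inr (by simp [zpow_add, zpow_mul, hsq])
  · rintro (rfl | rfl)
    exacts [one_mem _, flip_mem_flipGroup]

theorem eq_nil_of_toPSL_mem_flipGroup {w : Word} (h : toPSL w ∈ flipGroup) : w = [] := by
  obtain ⟨h₀₀, -, -, -, hlen⟩ := entries_prod_map_letter w
  have hM : ((w.map letter).prod = 1 ∨ (w.map letter).prod = -1) ∨
      ((w.map letter).prod = S ∨ (w.map letter).prod = -S) :=
    (mem_flipGroup_iff.mp h).imp (fun h => mk_eq_mk_iff_eq_or_eq_neg.mp h.symm)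
      fun h => mk_eq_mk_iff_eq_or_eq_neg.mp h.symm
  rcases hM with (hM | hM) | hM | hM <;> rw [hM] at h₀₀ hlen
  · simpa using hlen
  all_goals exact absurd h₀₀ (by decide)

/-- The word `w` is the word of turns of `g`: up to `flip` on both sides, `g` is the element
represented by `w`. Every `g` has exactly one word of turns. -/
def HasTurns (g : PSLZ) (w : Word) : Prop :=
  ∃ a ∈ flipGroup, ∃ b ∈ flipGroup, g = a * toPSL w * b

theorem hasTurns_toPSL (w : Word) : HasTurns (toPSL w) w :=
  ⟨1, one_mem _, 1, one_mem _, by simp⟩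

theorem HasTurns.mul_mul {g : PSLZ} {w : Word} (h : HasTurns g w) {a b : PSLZ}
    (ha : a ∈ flipGroup) (hb : b ∈ flipGroup) : HasTurns (a * g * b) w := by
  obtain ⟨c, hc, d, hd, rfl⟩ := h
  exact ⟨a * c, mul_mem ha hc, d * b, mul_mem hd hb, by simp only [mul_assoc]⟩

theorem HasTurns.inv {g : PSLZ} {w : Word} (h : HasTurns g w) : HasTurns g⁻¹ (transpose w) := by
  obtain ⟨a, ha, b, hb, rfl⟩ := h
  have hinv : (a * toPSL w * b)⁻¹ = (b⁻¹ * flip) * toPSL (transpose w) * (flip * a⁻¹) := by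
    rw [mul_inv_rev, mul_inv_rev, inv_toPSL]
    group
  rw [hinv]
  exact (hasTurns_toPSL _).mul_mul (mul_mem (inv_mem hb) flip_mem_flipGroup)
    (mul_mem flip_mem_flipGroup (inv_mem ha))

theorem eq_nil_of_hasTurns_one {w : Word} (h : HasTurns 1 w) : w = [] := by
  obtain ⟨a, ha, b, hb, h⟩ := h
  refine eq_nil_of_toPSL_mem_flipGroup ?_
  have hw : toPSL w = a⁻¹ * b⁻¹ := by
    rw [eq_inv_mul_iff_mul_eq, eq_inv_iff_mul_eq_one, h]
  exact hw ▸ mul_mem (inv_mem ha) (inv_mem hb)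

/-- The possible words of turns `u` of a product of two elements whose words of turns are `w` and
`v`: an end `y` of `w` cancels against its transpose at the beginning of `v`, and thereafter two
equal letters may merge into the other one. -/
inductive TurnsProduct : Word → Word → Word → Prop
  | cancel (x y z : Word) : TurnsProduct (x ++ y) (transpose y ++ z) (x ++ z)
  | merge (x : Word) (a : Bool) (y z : Word) :
      TurnsProduct (x ++ a :: y) (transpose y ++ a :: z) (x ++ (!a) :: z)

theorem TurnsProduct.snoc_cons {w v u : Word} (h : TurnsProduct w v u) (a : Bool) :
    TurnsProduct (w ++ [a]) ((!a) :: v) u := by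
  cases h with
  | cancel x y z => simpa using cancel x (y ++ [a]) z
  | merge x b y z => simpa using merge x b (y ++ [a]) z

theorem TurnsProduct.eq_transpose {w v : Word} (h : TurnsProduct w v []) : w = transpose v := by
  generalize hu : ([] : Word) = u at h
  cases h with
  | cancel x y z =>
    obtain ⟨rfl, rfl⟩ := List.append_eq_nil_iff.mp hu.symm
    simp
  | merge x a y z => simp at hu

theorem exists_turnsProduct_mul_flip_mul (w v : Word) :
    ∃ u, TurnsProduct w v u ∧ HasTurns (toPSL w * flip * toPSL v) u := by
  induction w using List.reverseRecOn generalizing v with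
  | nil =>
    refine ⟨v, .cancel [] [] v, ?_⟩
    simpa [toPSL_nil] using (hasTurns_toPSL v).mul_mul flip_mem_flipGroup (one_mem _)
  | append_singleton w a ih =>
    cases v with
    | nil =>
      refine ⟨w ++ [a], by simpa using TurnsProduct.cancel (w ++ [a]) [] [], ?_⟩
      simpa [toPSL_nil] using (hasTurns_toPSL (w ++ [a])).mul_mul (one_mem _) flip_mem_flipGroup
    | cons b v =>
      have hregroup : toPSL (w ++ [a]) * flip * toPSL (b :: v)
          = toPSL w * (toPSL [a] * flip * toPSL [b]) * toPSL v := by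
        rw [toPSL_append, toPSL_cons b]
        simp only [mul_assoc]
      rw [hregroup]
      obtain rfl | rfl : b = a ∨ b = !a := by cases a <;> cases b <;> simp
      · refine ⟨w ++ (!b) :: v, .merge w b [] v, ?_⟩
        rw [toPSL_mul_flip_mul_toPSL_self, mul_assoc, ← toPSL_cons, ← toPSL_append]
        exact hasTurns_toPSL _
      · obtain ⟨u, hu, hturns⟩ := ih v
        exact ⟨u, hu.snoc_cons a, by rwa [toPSL_mul_flip_mul_toPSL_not]⟩

theorem HasTurns.exists_mul {g h : PSLZ} {w v : Word} (hg : HasTurns g w) (hh : HasTurns h v) :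
    ∃ u, TurnsProduct w v u ∧ HasTurns (g * h) u := by
  obtain ⟨a, ha, b, hb, rfl⟩ := hg
  obtain ⟨c, hc, d, hd, rfl⟩ := hh
  suffices ∃ u, TurnsProduct w v u ∧ HasTurns (toPSL w * (b * c) * toPSL v) u by
    obtain ⟨u, hu, hturns⟩ := this
    exact ⟨u, hu, by simpa only [mul_assoc] using hturns.mul_mul ha hd⟩
  rcases mem_flipGroup_iff.mp (mul_mem hb hc) with h | h <;> rw [h]
  · refine ⟨w ++ v, by simpa using TurnsProduct.cancel w [] v, ?_⟩
    rw [mul_one, ← toPSL_append]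
    exact hasTurns_toPSL _
  · exact exists_turnsProduct_mul_flip_mul w v

theorem HasTurns.unique {g : PSLZ} {w v : Word} (hw : HasTurns g w) (hv : HasTurns g v) :
    w = v := by
  obtain ⟨u, hu, hone⟩ := hw.exists_mul hv.inv
  rw [mul_inv_cancel] at hone
  obtain rfl := eq_nil_of_hasTurns_one hone
  rw [hu.eq_transpose, transpose_transpose]

theorem exists_hasTurns (g : PSLZ) : ∃ w, HasTurns g w := by
  induction g using QuotientGroup.induction_on with
  | H A =>
  have hA : A ∈ Subgroup.closure {S, T} := by simp [SpecialLinearGroup.SL2Z_generators]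
  induction hA using Subgroup.closure_induction with
  | mem A hA =>
    rcases hA with rfl | rfl
    · exact ⟨[], flip, flip_mem_flipGroup, 1, one_mem _, by rw [toPSL_nil, mul_one, mul_one]; rfl⟩
    · have hT : T = ([true].map letter).prod := by decide
      exact ⟨[true], hT ▸ hasTurns_toPSL [true]⟩
  | one => exact ⟨[], hasTurns_toPSL []⟩
  | mul A B _ _ hA hB =>
    obtain ⟨w, hw⟩ := hA
    obtain ⟨v, hv⟩ := hB
    exact (hw.exists_mul hv).imp fun _ h => h.2
  | inv A _ hA =>
    obtain ⟨w, hw⟩ := hA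
    exact ⟨_, hw.inv⟩

theorem isOfFinOrder_or_isConj_flip_mul_toPSL (w : Word) :
    IsOfFinOrder (flip * toPSL w) ∨ ∃ v : Word, v ≠ [] ∧ IsConj (toPSL v) (flip * toPSL w) := by
  induction w using List.bidirectionalRec with
  | nil =>
    exact .inl (isOfFinOrder_iff_pow_eq_one.mpr
      ⟨2, two_pos, by rw [toPSL_nil, mul_one, sq, flip_mul_flip]⟩)
  | singleton a =>
    exact .inl (isOfFinOrder_iff_pow_eq_one.mpr
      ⟨3, three_pos, flip_mul_toPSL_singleton_pow_three a⟩)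
  | cons_append a u b ih =>
    have hconj : IsConj (toPSL [b] * flip * toPSL [a] * toPSL u)
        (flip * toPSL (a :: (u ++ [b]))) := by
      rw [toPSL_cons a (u ++ [b]), toPSL_append, isConj_iff]
      exact ⟨(toPSL [b])⁻¹, by group⟩
    obtain rfl | rfl : b = a ∨ a = !b := by cases a <;> cases b <;> simp
    · rw [toPSL_mul_flip_mul_toPSL_self, ← toPSL_cons] at hconj
      exact .inr ⟨_, by simp, hconj⟩
    · rw [toPSL_mul_flip_mul_toPSL_not] at hconj
      exact ih.imp (fun h => hconj.isOfFinOrder h) fun ⟨v, hv, h⟩ => ⟨v, hv, h.trans hconj⟩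

theorem isOfFinOrder_or_isConj_toPSL (g : PSLZ) :
    IsOfFinOrder g ∨ ∃ w : Word, w ≠ [] ∧ IsConj (toPSL w) g := by
  obtain ⟨w, a, ha, b, hb, rfl⟩ := exists_hasTurns g
  have hconj : IsConj (b * a * toPSL w) (a * toPSL w * b) :=
    isConj_iff.mpr ⟨b⁻¹, by group⟩
  rcases mem_flipGroup_iff.mp (mul_mem hb ha) with h | h <;> rw [h] at hconj
  · rw [one_mul] at hconj
    obtain rfl | hw := eq_or_ne w []
    · exact .inl (hconj.isOfFinOrder (by simp [toPSL_nil]))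
    · exact .inr ⟨w, hw, hconj⟩
  · exact (isOfFinOrder_or_isConj_flip_mul_toPSL w).imp (fun h => hconj.isOfFinOrder h)
      fun ⟨v, hv, h⟩ => ⟨v, hv, h.trans hconj⟩

/-- The word of turns of an element of `PSL₂(ℤ)`. -/
noncomputable def turns (g : PSLZ) : Word := (exists_hasTurns g).choose

theorem hasTurns_turns (g : PSLZ) : HasTurns g (turns g) := (exists_hasTurns g).choose_spec

theorem HasTurns.turns_eq {g : PSLZ} {w : Word} (h : HasTurns g w) : turns g = w :=
  (hasTurns_turns g).unique h

theorem turns_toPSL (w : Word) : turns (toPSL w) = w := (hasTurns_toPSL w).turns_eq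

theorem turnsProduct_turns (A B : PSLZ) : TurnsProduct (turns A) (turns B) (turns (A * B)) := by
  obtain ⟨u, hu, hturns⟩ := (hasTurns_turns A).exists_mul (hasTurns_turns B)
  rwa [hturns.turns_eq]

section LinearOccurrences

theorem count_le_count_add {p q : ℕ → Prop} [DecidablePred p] [DecidablePred q] {m n : ℕ}
    (h : ∀ k, k + m ≤ n → q k → p k) : Nat.count q n ≤ Nat.count p n + m := by
  rcases le_total n m with hnm | hnm
  · exact (Nat.count_le _).trans (hnm.trans (Nat.le_add_left _ _))
  · obtain ⟨a, rfl⟩ := Nat.exists_eq_add_of_le' hnm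
    rw [Nat.count_add q]
    refine add_le_add ?_ (Nat.count_le _)
    calc Nat.count q a ≤ Nat.count p a := Nat.count_mono_left fun k hk => h k (by lia)
      _ ≤ Nat.count p (a + m) := Nat.count_monotone p (Nat.le_add_right a m)

theorem count_mul_of_periodic {p : ℕ → Prop} [DecidablePred p] {a : ℕ}
    (h : Function.Periodic p a) (n : ℕ) : Nat.count p (n * a) = n * Nat.count p a := by
  induction n with
  | zero => simp
  | succ n ih =>
    have hshift : (fun k => p (n * a + k)) = p := by
      funext k
      rw [add_comm]
      exact h.nat_mul n k
    rw [Nat.succ_mul, Nat.succ_mul, Nat.count_add, ih]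
    simp only [hshift]

variable {α : Type*}

theorem isPrefix_drop_iff {P w : List α} {j : ℕ} (hj : j ≤ w.length) :
    P <+: w.drop j ↔ ∃ x y, x.length = j ∧ x ++ (P ++ y) = w := by
  constructor
  · rintro ⟨y, hy⟩
    exact ⟨w.take j, y, by simpa using hj, by rw [hy, List.take_append_drop]⟩
  · rintro ⟨x, y, rfl, rfl⟩
    simp

variable [DecidableEq α]

/-- The number of occurrences of `P` in `w`, where `w` is not continued periodically; the empty
word occurs at each of the `w.length + 1` positions. -/
def linearOcc (P w : List α) : ℕ := Nat.count (fun j => P <+: w.drop j) (w.length + 1)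

theorem linearOcc_append (P x y : List α) :
    linearOcc P (x ++ y) =
      Nat.count (fun j => P <+: (x ++ y).drop j) x.length + linearOcc P y := by
  rw [linearOcc, linearOcc, List.length_append, add_assoc, Nat.count_add]
  simp only [List.drop_append, List.drop_eq_nil_of_le (Nat.le_add_right _ _),
    Nat.add_sub_cancel_left, List.nil_append]

theorem linearOcc_add_linearOcc_le (P x y : List α) :
    linearOcc P x + linearOcc P y ≤ linearOcc P (x ++ y) + 1 := by
  have hx : linearOcc P x ≤ Nat.count (fun j => P <+: (x ++ y).drop j) x.length + 1 := by
    rw [linearOcc, Nat.count_add]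
    refine add_le_add (Nat.count_mono_left fun j hj h => ?_) (Nat.count_le _)
    rw [List.drop_append_of_le_length hj.le]
    exact h.trans (List.prefix_append _ _)
  rw [linearOcc_append]
  lia

theorem linearOcc_append_le (P x y : List α) :
    linearOcc P (x ++ y) ≤ linearOcc P x + linearOcc P y + P.length := by
  have hx : Nat.count (fun j => P <+: (x ++ y).drop j) x.length ≤
      Nat.count (fun j => P <+: x.drop j) x.length + P.length := by
    refine count_le_count_add fun j hj h => ?_
    rw [List.drop_append_of_le_length (by lia)] at h
    exact List.prefix_of_prefix_length_le h (List.prefix_append _ _)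
      (by rw [List.length_drop]; lia)
  have hmono : Nat.count (fun j => P <+: x.drop j) x.length ≤ linearOcc P x :=
    Nat.count_monotone _ (Nat.le_succ _)
  rw [linearOcc_append]
  lia

theorem linearOcc_le_linearOcc_transpose (P w : Word) :
    linearOcc P w ≤ linearOcc (transpose P) (transpose w) := by
  have hmem : ∀ j ∈ (Finset.range (w.length + 1)).filter (fun j => P <+: w.drop j),
      ∃ x y, x.length = j ∧ x ++ (P ++ y) = w := fun j hj => by
    rw [Finset.mem_filter, Finset.mem_range] at hj
    exact (isPrefix_drop_iff (Nat.le_of_lt_succ hj.1)).mp hj.2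
  simp only [linearOcc, Nat.count_eq_card_filter_range]
  refine Finset.card_le_card_of_injOn (fun j => w.length - P.length - j) (fun j hj => ?_)
    fun j hj k hk hjk => ?_
  · obtain ⟨x, y, rfl, hw⟩ := hmem j hj
    simp only [Finset.coe_filter, Finset.mem_range, Set.mem_ofPred_eq, length_transpose]
    refine ⟨by lia, (isPrefix_drop_iff (by rw [length_transpose]; lia)).mpr
      ⟨transpose y, transpose x, ?_, by simp [← hw]⟩⟩
    simp only [← hw, List.length_append, length_transpose]
    lia
  · obtain ⟨x, y, rfl, hw⟩ := hmem j hj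
    obtain ⟨x', y', rfl, hw'⟩ := hmem k hk
    have hlen := congrArg List.length hw
    have hlen' := congrArg List.length hw'
    simp only [List.length_append] at hlen hlen' hjk
    lia

theorem linearOcc_transpose (P w : Word) :
    linearOcc (transpose P) (transpose w) = linearOcc P w := by
  refine le_antisymm ?_ (linearOcc_le_linearOcc_transpose P w)
  simpa using linearOcc_le_linearOcc_transpose (transpose P) (transpose w)

end LinearOccurrences

section Window

/-- The factor of length `n` of the periodic sequence `w^∞` which starts at the position `j`. -/
def window (w : Word) (j n : ℕ) : Word := (List.range' j n).map (periodic w)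

@[simp]
theorem length_window (w : Word) (j n : ℕ) : (window w j n).length = n := by simp [window]

theorem window_add (w : Word) (j m n : ℕ) :
    window w j (m + n) = window w j m ++ window w (j + m) n := by
  rw [window, window, window, ← List.map_append, List.range'_append_1]

theorem drop_window (w : Word) (j n k : ℕ) :
    (window w j n).drop k = window w (j + k) (n - k) := by
  simp [window, ← List.map_drop, List.drop_range']

theorem isPrefix_window_iff {P w : Word} {j n : ℕ} :
    P <+: window w j n ↔ P.length ≤ n ∧ window w j P.length = P := by
  constructor
  · intro h
    obtain ⟨k, rfl⟩ := Nat.exists_eq_add_of_le (by simpa using h.length_le : P.length ≤ n)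
    rw [window_add] at h
    exact ⟨Nat.le_add_right _ _,
      (List.prefix_of_prefix_length_le h (List.prefix_append _ _) (by simp)).eq_of_length
        (by simp) |>.symm⟩
  · rintro ⟨hn, hP⟩
    obtain ⟨k, rfl⟩ := Nat.exists_eq_add_of_le hn
    rw [window_add, hP]
    exact List.prefix_append _ _

theorem periodic_window (w : Word) (n : ℕ) :
    Function.Periodic (fun j => window w j n) w.length := by
  intro j
  simp only [window]
  rw [add_comm, ← List.map_add_range', List.map_map]
  exact List.map_congr_left fun k _ => by simp [periodic]

theorem window_length (w : Word) (j : ℕ) : window w j w.length = w.rotate j := by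
  refine List.ext_getElem (by simp) fun i hi _ => ?_
  rw [length_window] at hi
  have hpos : 0 < w.length := by lia
  rw [List.getElem_rotate]
  simp [window, periodic, Nat.add_comm j i, Nat.mod_lt _ hpos]

theorem window_zero_length (w : Word) : window w 0 w.length = w := by
  rw [window_length, List.rotate_zero]

theorem occ_eq_count (P w : Word) :
    occ P w = Nat.count (fun j => window w j P.length = P) w.length := by
  rw [Nat.count_eq_card_filter_range, occ]
  refine congrArg Finset.card (Finset.filter_congr fun j _ => ?_)
  refine ⟨fun h => List.ext_getElem (by simp) fun i _ hi => ?_, fun h i => ?_⟩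
  · simpa [window] using (h ⟨i, hi⟩).symm
  · have hi : (window w j P.length)[(i : ℕ)]? = P[(i : ℕ)]? := by rw [h]
    simpa [window] using hi.symm

theorem mul_occ_eq_count (P w : Word) (n : ℕ) :
    n * occ P w = Nat.count (fun j => window w j P.length = P) (n * w.length) := by
  rw [occ_eq_count, count_mul_of_periodic]
  exact fun j => congrArg (· = P) (periodic_window w P.length j)

theorem linearOcc_window_le (P w : Word) (n : ℕ) :
    linearOcc P (window w 0 n) ≤ Nat.count (fun j => window w j P.length = P) n + 1 := by
  rw [linearOcc, length_window, Nat.count_add]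
  refine add_le_add (Nat.count_mono_left fun j _ h => ?_) (Nat.count_le _)
  rw [drop_window, zero_add, isPrefix_window_iff] at h
  exact h.2

theorem count_window_le (P w : Word) (n : ℕ) :
    Nat.count (fun j => window w j P.length = P) n ≤ linearOcc P (window w 0 n) + P.length := by
  rw [linearOcc, length_window]
  refine (count_le_count_add fun j hj h => ?_).trans
    (Nat.add_le_add_right (Nat.count_monotone _ (Nat.le_succ _)) _)
  rw [drop_window, zero_add, isPrefix_window_iff]
  exact ⟨by lia, h⟩

theorem toPSL_window_mul_length (w : Word) (n : ℕ) :
    toPSL (window w 0 (n * w.length)) = toPSL w ^ n := by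
  induction n with
  | zero => simp [window, toPSL_nil]
  | succ n ih =>
    have hperiod : window w 0 w.length = window w (n * w.length) w.length := by
      simpa using ((periodic_window w w.length).nat_mul_eq n).symm
    rw [Nat.succ_mul, window_add, toPSL_append, ih, zero_add, ← hperiod, window_zero_length,
      pow_succ]

end Window

section Asymmetry

/-- The analogue of `mas` for the occurrences of a pattern in a linear word. -/
def linearAsymmetry (P w : Word) : ℝ := linearOcc P w - linearOcc (transpose P) w

theorem abs_linearAsymmetry_append_sub_le (P x y : Word) :
    |linearAsymmetry P (x ++ y) - linearAsymmetry P x - linearAsymmetry P y| ≤ P.length + 1 := by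
  have hge := linearOcc_add_linearOcc_le P x y
  have hle := linearOcc_append_le P x y
  have hge' := linearOcc_add_linearOcc_le (transpose P) x y
  have hle' := linearOcc_append_le (transpose P) x y
  rw [length_transpose] at hle'
  rify at hge hle hge' hle'
  unfold linearAsymmetry
  exact abs_le.mpr ⟨by linarith, by linarith⟩

theorem linearAsymmetry_transpose (P w : Word) :
    linearAsymmetry P (transpose w) = -linearAsymmetry P w := by
  have h := linearOcc_transpose (transpose P) w
  rw [transpose_transpose] at h
  rw [linearAsymmetry, linearAsymmetry, linearOcc_transpose, h, neg_sub]

theorem abs_linearAsymmetry_le (P w : Word) : |linearAsymmetry P w| ≤ w.length + 1 :=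
  abs_sub_le_of_nonneg_of_le (Nat.cast_nonneg _) (mod_cast Nat.count_le _) (Nat.cast_nonneg _)
    (mod_cast Nat.count_le _)

theorem hasDefectLE_comp_turns {ψ : Word → ℝ} {K : ℝ}
    (hadd : ∀ x y, |ψ (x ++ y) - ψ x - ψ y| ≤ K) (hodd : ∀ w, ψ (transpose w) = -ψ w)
    (hletter : ∀ a, |ψ [a]| ≤ K) : HasDefectLE (fun A => ψ (turns A)) (9 * K) := by
  have hadd_letter : ∀ x a y, |ψ (x ++ a :: y) - ψ x - ψ [a] - ψ y| ≤ 2 * K := fun x a y => by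
    have houter := abs_le.mp (hadd x (a :: y))
    have hinner := abs_le.mp (hadd [a] y)
    rw [List.singleton_append] at hinner
    exact abs_le.mpr ⟨by linarith, by linarith⟩
  intro A B
  beta_reduce
  have h := turnsProduct_turns A B
  generalize turns A = w, turns B = v, turns (A * B) = u at h ⊢
  cases h with
  | cancel x y z =>
    have hw := abs_le.mp (hadd x y)
    have hv := abs_le.mp (hadd (transpose y) z)
    have hu := abs_le.mp (hadd x z)
    rw [hodd] at hv
    exact abs_le.mpr ⟨by linarith, by linarith⟩
  | merge x a y z =>
    have hw := abs_le.mp (hadd_letter x a y)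
    have hv := abs_le.mp (hadd_letter (transpose y) a z)
    have hu := abs_le.mp (hadd_letter x (!a) z)
    have ha := abs_le.mp (hletter a)
    have hnot : ψ [!a] = -ψ [a] := by simpa using hodd [a]
    rw [hodd] at hv
    exact abs_le.mpr ⟨by linarith, by linarith⟩

theorem hasDefectLE_linearAsymmetry_turns (P : Word) :
    HasDefectLE (fun A => linearAsymmetry P (turns A)) (9 * (P.length + 2)) := by
  refine hasDefectLE_comp_turns (fun x y => ?_) (linearAsymmetry_transpose P) fun a => ?_
  · linarith [abs_linearAsymmetry_append_sub_le P x y]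
  · have h := abs_linearAsymmetry_le P [a]
    have hlen : (0 : ℝ) ≤ P.length := Nat.cast_nonneg _
    rw [List.length_singleton, Nat.cast_one] at h
    linarith

theorem abs_linearAsymmetry_window_sub_le (P w : Word) (n : ℕ) :
    |linearAsymmetry P (window w 0 (n * w.length)) - n * (occ P w - occ (transpose P) w)| ≤
      P.length + 1 := by
  have hle := linearOcc_window_le P w (n * w.length)
  have hge := count_window_le P w (n * w.length)
  have hle' := linearOcc_window_le (transpose P) w (n * w.length)
  have hge' := count_window_le (transpose P) w (n * w.length)
  rw [← mul_occ_eq_count] at hle hge hle' hge'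
  rw [length_transpose] at hge'
  rify at hge hle hge' hle'
  unfold linearAsymmetry
  exact abs_le.mpr ⟨by linarith, by linarith⟩

theorem tendsto_linearAsymmetry_turns_of_isConj (P : Word) {w : Word} {A : PSLZ}
    (hA : IsConj (toPSL w) A) :
    Tendsto (fun n : ℕ => linearAsymmetry P (turns (A ^ n)) / n) atTop
      (𝓝 (occ P w - occ (transpose P) w)) := by
  refine (hasDefectLE_linearAsymmetry_turns P).tendsto_pow_div_of_isConj hA
    (tendsto_div_of_abs_sub_mul_le (C := P.length + 1) fun n => ?_)
  rw [← toPSL_window_mul_length, turns_toPSL]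
  exact abs_linearAsymmetry_window_sub_le P w n

theorem tendsto_linearAsymmetry_turns (P : Word) (A : PSLZ) :
    Tendsto (fun n : ℕ => linearAsymmetry P (turns (A ^ n)) / n) atTop (𝓝 (masReal P A)) := by
  by_cases h : ∃ w : Word, w ≠ [] ∧ IsConj (toPSL w) A
  · have hmas : masReal P A = occ P h.choose - occ (transpose P) h.choose := by
      simp [masReal, mas, dif_pos h]
    rw [hmas]
    exact tendsto_linearAsymmetry_turns_of_isConj P h.choose_spec.2
  · have hmas : masReal P A = 0 := by simp [masReal, mas, dif_neg h]
    rw [hmas]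
    exact tendsto_pow_div_of_isOfFinOrder (fun A => linearAsymmetry P (turns A))
      ((isOfFinOrder_or_isConj_toPSL A).resolve_right h)

theorem masReal_mem_PX (P : Word) : masReal P ∈ PX PSLZ :=
  (hasDefectLE_linearAsymmetry_turns P).mem_PX_of_tendsto (tendsto_linearAsymmetry_turns P)

theorem mas_eq_of_isConj (P : Word) {w : Word} {A : PSLZ} (hA : IsConj (toPSL w) A) :
    mas P A = occ P w - occ (transpose P) w := by
  have h := tendsto_nhds_unique (tendsto_linearAsymmetry_turns P A)
    (tendsto_linearAsymmetry_turns_of_isConj P hA)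
  rw [masReal] at h
  exact_mod_cast h

theorem mas_toPSL (P w : Word) : mas P (toPSL w) = occ P w - occ (transpose P) w :=
  mas_eq_of_isConj P (IsConj.refl _)

theorem isCommutingAdditive_mas (P : Word) : IsCommutingAdditive (mas P) where
  map_isConj A B h := by
    have h' := (IsCommutingAdditive.of_mem_PX (masReal_mem_PX P)).map_isConj h
    simp only [masReal] at h'
    exact_mod_cast h'
  map_mul A B h := by
    have h' := (IsCommutingAdditive.of_mem_PX (masReal_mem_PX P)).map_mul h
    simp only [masReal] at h'
    exact_mod_cast h'

end Asymmetry

section CyclicWords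

variable {M : Type*} [AddCommGroup M] {f : PSLZ → M}

theorem isConj_toPSL_of_isRotated {v w : Word} (h : v ~r w) : IsConj (toPSL v) (toPSL w) := by
  obtain ⟨n, hn, rfl⟩ := List.isRotated_iff_mod.mp h
  rw [List.rotate_eq_drop_append_take hn, isConj_iff]
  refine ⟨(toPSL (v.take n))⁻¹, ?_⟩
  conv_lhs => rw [← List.take_append_drop n v, toPSL_append]
  simp [toPSL_append]

theorem IsCommutingAdditive.map_toPSL_eq_of_isRotated (hf : IsCommutingAdditive f) {v w : Word}
    (h : v ~r w) : f (toPSL v) = f (toPSL w) :=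
  hf.map_isConj (isConj_toPSL_of_isRotated h)

theorem IsCommutingAdditive.map_toPSL_transpose (hf : IsCommutingAdditive f) (w : Word) :
    f (toPSL (transpose w)) = -f (toPSL w) := by
  rw [← hf.map_inv, inv_toPSL]
  exact hf.map_isConj (isConj_iff.mpr ⟨flip, by rw [flip_inv]⟩)

theorem occ_eq_count_rotate {P w : Word} (h : P.length = w.length) :
    occ P w = Nat.count (fun j => w.rotate j = P) w.length := by
  simp only [occ_eq_count, h, window_length]

theorem occ_eq_zero_of_not_isRotated {P w : Word} (hlen : P.length = w.length) (h : ¬ P ~r w) :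
    occ P w = 0 := by
  rw [occ_eq_count_rotate hlen, Nat.count_iff_forall_not]
  exact fun j _ hj => h (List.IsRotated.symm ⟨j, hj⟩)

end CyclicWords

section Unbordered

/-- The word `P` has no border, that is, no prefix other than `[]` and `P` that is also a suffix
of `P`. -/
def Unbordered {α : Type*} (P : List α) : Prop :=
  ∀ s, s <+: P → s <:+ P → s = [] ∨ s = P

theorem Unbordered.transpose {P : Word} (hP : Unbordered P) : Unbordered (transpose P) := by
  intro s hpre hsuf
  have hsuf' : ModularWord.transpose s <:+ P := by
    rw [← transpose_transpose P]
    exact List.reverse_suffix.mpr (hpre.map not)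
  have hpre' : ModularWord.transpose s <+: P := by
    rw [← transpose_transpose P]
    exact List.reverse_prefix.mpr (hsuf.map not)
  rw [← transpose_transpose s]
  exact (hP _ hpre' hsuf').imp (fun h => by rw [h, transpose_nil]) fun h => by rw [h]

theorem occ_eq_zero_of_length_lt {P w : Word} (hP : Unbordered P) (hlt : w.length < P.length) :
    occ P w = 0 := by
  rw [occ_eq_count, Nat.count_iff_forall_not]
  intro j hj hocc
  obtain ⟨k, hk⟩ := Nat.exists_eq_add_of_le hlt.le
  have hpre : window w j k <+: P := by
    rw [← hocc, hk, add_comm, window_add]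
    exact List.prefix_append _ _
  have hsuf : window w j k <:+ P := by
    have hshift : window w (j + w.length) k = window w j k := periodic_window w k j
    rw [← hocc, hk, window_add, hshift]
    exact List.suffix_append _ _
  have hborder := (hP _ hpre hsuf).imp (congrArg List.length) (congrArg List.length)
  rw [length_window, List.length_nil] at hborder
  lia

theorem mas_eq_zero_of_length_lt {P w : Word} (hP : Unbordered P) (hlt : w.length < P.length)
    {A : PSLZ} (hA : IsConj (toPSL w) A) : mas P A = 0 := by
  rw [mas_eq_of_isConj P hA, occ_eq_zero_of_length_lt hP hlt,
    occ_eq_zero_of_length_lt hP.transpose (by rwa [length_transpose]), sub_self]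

end Unbordered

section Lyndon

theorem append_lt_append_of_lt {α : Type*} [LT α] {x y : List α} (hlen : x.length = y.length)
    (h : x < y) (a b : List α) : x ++ a < y ++ b := by
  induction x generalizing y with
  | nil =>
    rw [List.length_eq_zero_iff.mp hlen.symm] at h
    exact absurd h (List.not_lt_nil _)
  | cons c x ih =>
    cases y with
    | nil => exact absurd hlen (Nat.succ_ne_zero _)
    | cons d y =>
      rw [List.cons_append, List.cons_append, List.cons_lt_cons_iff]
      exact (List.cons_lt_cons_iff.mp h).imp_right fun ⟨hcd, hxy⟩ =>
        ⟨hcd, ih (Nat.succ.inj hlen) hxy⟩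

theorem append_lt_append_swap_of_mem_lyndonWords {x y : Word} (h : x ++ y ∈ lyndonWords)
    (hx : x ≠ []) (hy : y ≠ []) : y ++ x < x ++ y := by
  have hlt : x.length < (x ++ y).length := by
    rw [List.length_append]
    exact Nat.lt_add_of_pos_right (List.length_pos_iff.mpr hy)
  simpa using h x.length (List.length_pos_iff.mpr hx) hlt

theorem unbordered_of_mem_lyndonWords {P : Word} (hP : P ∈ lyndonWords) : Unbordered P := by
  rintro s ⟨y, hy⟩ ⟨x, hx⟩
  by_contra! ⟨hs, hsP⟩
  have hlen : x.length = y.length := by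
    have h := congrArg List.length (hx.trans hy.symm)
    simp only [List.length_append] at h
    lia
  have hyne : y ≠ [] := by
    rintro rfl
    exact hsP (by simpa using hy)
  have hxne : x ≠ [] := by
    rintro rfl
    exact hsP hx
  have hys : y ++ s < P := by
    rw [← hy] at hP ⊢
    exact append_lt_append_swap_of_mem_lyndonWords hP hs hyne
  have hsx : s ++ x < P := by
    rw [← hx] at hP ⊢
    exact append_lt_append_swap_of_mem_lyndonWords hP hxne hs
  rcases lt_trichotomy x y with hxy | rfl | hyx
  · exact (hx ▸ append_lt_append_of_lt hlen hxy s s).not_gt hys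
  · exact hsx.ne hy
  · exact (hy ▸ List.append_left_lt hyx : P < s ++ x).not_gt hsx

theorem occ_self_of_mem_lyndonWords {P : Word} (hP : P ∈ lyndonWords) (hne : P ≠ []) :
    occ P P = 1 := by
  obtain ⟨n, hn⟩ := Nat.exists_eq_add_of_lt (List.length_pos_iff.mpr hne)
  have hnot : Nat.count (fun k => P.rotate (k + 1) = P) n = 0 :=
    Nat.count_iff_forall_not.mpr fun k hk => (hP (k + 1) k.succ_pos (by lia)).ne
  rw [occ_eq_count_rotate rfl, hn, zero_add, Nat.count_succ', hnot]
  simp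

theorem le_of_isRotated_of_mem_lyndonWords {P Q : Word} (hP : P ∈ lyndonWords) (h : P ~r Q) :
    Q ≤ P := by
  obtain ⟨k, hk, rfl⟩ := List.isRotated_iff_mod.mp h
  rcases Nat.eq_zero_or_pos k with rfl | hk0
  · rw [List.rotate_zero]
  rcases hk.eq_or_lt with rfl | hlt
  · rw [List.rotate_length]
  · exact (hP k hk0 hlt).le

theorem eq_of_isRotated_of_mem_lyndonWords {P Q : Word} (hP : P ∈ lyndonWords)
    (hQ : Q ∈ lyndonWords) (h : P ~r Q) : P = Q :=
  le_antisymm (le_of_isRotated_of_mem_lyndonWords hQ h.symm)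
    (le_of_isRotated_of_mem_lyndonWords hP h)

theorem isGreatest_foldr_max {α : Type*} [LinearOrder α] [OrderBot α] {l : List α} (hl : l ≠ []) :
    IsGreatest {a | a ∈ l} (l.foldr max ⊥) := by
  have h := (List.foldr_max_of_ne_nil hl).symm
  exact ⟨List.maximum_mem h, fun a ha => List.le_maximum_of_mem ha h⟩

/-- The greatest cyclic permutation of a word; `lyndonTranspose P` is `maxRotation (transpose P)`.
-/
def maxRotation (w : Word) : Word := w.cyclicPermutations.foldr max []

theorem isGreatest_maxRotation (w : Word) : IsGreatest {v | v ~r w} (maxRotation w) := by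
  let _ : OrderBot Word := { bot := [], bot_le := fun a => not_lt.mp (List.not_lt_nil a) }
  have hset : {v | v ~r w} = {v | v ∈ w.cyclicPermutations} :=
    Set.ext fun v => List.mem_cyclicPermutations_iff.symm
  rw [hset]
  exact isGreatest_foldr_max (List.cyclicPermutations_ne_nil w)

theorem maxRotation_isRotated (w : Word) : maxRotation w ~r w := (isGreatest_maxRotation w).1

theorem eq_maxRotation {P w : Word} (hP : P ∈ lyndonWords) (h : P ~r w) : P = maxRotation w :=
  le_antisymm ((isGreatest_maxRotation w).2 h)
    (le_of_isRotated_of_mem_lyndonWords hP (h.trans (maxRotation_isRotated w).symm))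

theorem exists_append_eq_maxRotation_of_notMem {w : Word} (h : maxRotation w ∉ lyndonWords) :
    ∃ x y, x ≠ [] ∧ y ≠ [] ∧ x ++ y = maxRotation w ∧ x ++ y = y ++ x := by
  simp only [lyndonWords, Set.mem_ofPred_eq, not_forall] at h
  obtain ⟨k, hpos, hk, hnlt⟩ := h
  have hrot : (maxRotation w).rotate k = maxRotation w :=
    ((isGreatest_maxRotation w).2
      ((List.IsRotated.forall _ k).trans (maxRotation_isRotated w))).eq_of_not_lt hnlt
  rw [List.rotate_eq_drop_append_take hk.le] at hrot
  exact ⟨(maxRotation w).take k, (maxRotation w).drop k,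
    List.ne_nil_of_length_pos (by rw [List.length_take]; lia),
    List.ne_nil_of_length_pos (by rw [List.length_drop]; lia),
    List.take_append_drop k _, by rw [List.take_append_drop, hrot]⟩

theorem IsCommutingAdditive.map_toPSL_eq_zero {M : Type*} [AddCommGroup M] {f : PSLZ → M}
    (hf : IsCommutingAdditive f) (hlyndon : ∀ Q ∈ lyndonWords, f (toPSL Q) = 0) (w : Word) :
    f (toPSL w) = 0 := by
  induction hn : w.length using Nat.strong_induction_on generalizing w with
  | _ n ih =>
    rw [← hf.map_toPSL_eq_of_isRotated (maxRotation_isRotated w)]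
    by_cases hmem : maxRotation w ∈ lyndonWords
    · exact hlyndon _ hmem
    obtain ⟨x, y, hx, hy, hxy, hcomm⟩ := exists_append_eq_maxRotation_of_notMem hmem
    have hlen : x.length + y.length = n := by
      rw [← List.length_append, hxy, (maxRotation_isRotated w).perm.length_eq, hn]
    have hx' := List.length_pos_iff.mpr hx
    have hy' := List.length_pos_iff.mpr hy
    have hcommute : Commute (toPSL x) (toPSL y) := by
      rw [Commute, SemiconjBy, ← toPSL_append, hcomm, toPSL_append]
    rw [← hxy, toPSL_append, hf.map_mul hcommute, ih _ (by lia) x rfl, ih _ (by lia) y rfl,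
      add_zero]

theorem finite_setOf_mas_ne_zero (A : PSLZ) : {P ∈ lyndonWords | mas P A ≠ 0}.Finite := by
  rcases isOfFinOrder_or_isConj_toPSL A with hA | ⟨w, -, hA⟩
  · refine Set.finite_empty.subset fun P hP => hP.2 ?_
    exact (isCommutingAdditive_mas P).eq_zero_of_isOfFinOrder hA
  · refine (List.finite_length_le Bool w.length).subset fun P hP => ?_
    by_contra hlen
    exact hP.2 (mas_eq_zero_of_length_lt (unbordered_of_mem_lyndonWords hP.1) (not_le.mp hlen) hA)

end Lyndon

section HalfSystem

/-- A set of Lyndon words that contains exactly one word from each pair of Lyndon words which are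
exchanged by transposition, up to rotation, and no Lyndon word that is a rotation of its own
transpose. -/
structure IsHalfSystem (X : Set Word) : Prop where
  subset_lyndonWords : X ⊆ lyndonWords
  not_transpose_isRotated : ∀ P ∈ X, ∀ Q ∈ X, ¬ transpose P ~r Q
  mem_or_exists_transpose_isRotated :
    ∀ Q ∈ lyndonWords, ¬ transpose Q ~r Q → Q ∈ X ∨ ∃ P ∈ X, transpose P ~r Q

theorem isHalfSystem_of_partition {X Y : Set Word} (hdisj : Disjoint X Y)
    (hunion : X ∪ Y = lyndonWords \ symmetricLyndonWords) (hbij : Set.BijOn lyndonTranspose X Y) :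
    IsHalfSystem X where
  subset_lyndonWords P hP := (hunion.subset (Or.inl hP)).1
  not_transpose_isRotated P hP Q hQ h := by
    have hQP : Q = lyndonTranspose P := eq_maxRotation (hunion.subset (Or.inl hQ)).1 h.symm
    exact Set.disjoint_left.mp hdisj hQ (hQP ▸ hbij.mapsTo hP)
  mem_or_exists_transpose_isRotated Q hQ hasymm := by
    rcases hunion.superset ⟨hQ, fun h => hasymm h.2⟩ with h | h
    · exact Or.inl h
    · obtain ⟨P, hP, rfl⟩ := hbij.surjOn h
      exact Or.inr ⟨P, hP, (maxRotation_isRotated _).symm⟩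

namespace IsHalfSystem

variable {X : Set Word}

theorem mas_self (hX : IsHalfSystem X) {P : Word} (hP : P ∈ X) : mas P (toPSL P) = 1 := by
  have hasymm := hX.not_transpose_isRotated P hP P hP
  have hne : P ≠ [] := by
    rintro rfl
    exact hasymm (List.IsRotated.refl _)
  rw [mas_toPSL, occ_self_of_mem_lyndonWords (hX.subset_lyndonWords hP) hne,
    occ_eq_zero_of_not_isRotated (length_transpose P) hasymm, Nat.cast_one, Nat.cast_zero, sub_zero]

theorem mas_eq_zero_of_ne (hX : IsHalfSystem X) {P Q : Word} (hP : P ∈ X) (hQ : Q ∈ X)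
    (hne : P ≠ Q) (hlen : Q.length ≤ P.length) : mas P (toPSL Q) = 0 := by
  have hPL := hX.subset_lyndonWords hP
  rcases hlen.lt_or_eq with hlt | heq
  · exact mas_eq_zero_of_length_lt (unbordered_of_mem_lyndonWords hPL) hlt (IsConj.refl _)
  · have hnot : ¬ P ~r Q := fun h =>
      hne (eq_of_isRotated_of_mem_lyndonWords hPL (hX.subset_lyndonWords hQ) h)
    rw [mas_toPSL, occ_eq_zero_of_not_isRotated heq.symm hnot,
      occ_eq_zero_of_not_isRotated ((length_transpose P).trans heq.symm)
        (hX.not_transpose_isRotated P hP Q hQ), sub_self]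

theorem finite_setOf_mas_ne_zero (hX : IsHalfSystem X) (A : PSLZ) :
    {P ∈ X | mas P A ≠ 0}.Finite :=
  (ModularWord.finite_setOf_mas_ne_zero A).subset fun _ hP => ⟨hX.subset_lyndonWords hP.1, hP.2⟩

variable {M : Type*} [AddCommGroup M]

theorem isCommutingAdditive_finsum_mas_smul (hX : IsHalfSystem X) (m : X → M) :
    IsCommutingAdditive fun A => ∑ᶠ P : X, mas P A • m P := by
  refine .finsum (fun P => (isCommutingAdditive_mas P).smul_const (m P)) fun A => ?_
  refine ((hX.finite_setOf_mas_ne_zero A).preimage Subtype.val_injective.injOn).subset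
    fun P hP => ⟨P.2, fun h => hP ?_⟩
  simp only [h, zero_smul]

variable [IsAddTorsionFree M] {f : PSLZ → M}

theorem eq_zero_of_forall_map_toPSL_eq_zero (hX : IsHalfSystem X) (hf : IsCommutingAdditive f)
    (h : ∀ P ∈ X, f (toPSL P) = 0) (A : PSLZ) : f A = 0 := by
  have hlyndon : ∀ Q ∈ lyndonWords, f (toPSL Q) = 0 := fun Q hQ => by
    by_cases hsymm : transpose Q ~r Q
    · have hneg := hf.map_toPSL_eq_of_isRotated hsymm
      rw [hf.map_toPSL_transpose] at hneg
      exact self_eq_neg.mp hneg.symm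
    · rcases hX.mem_or_exists_transpose_isRotated Q hQ hsymm with hQX | ⟨P, hP, hPQ⟩
      · exact h Q hQX
      · rw [← hf.map_toPSL_eq_of_isRotated hPQ, hf.map_toPSL_transpose, h P hP, neg_zero]
  rcases isOfFinOrder_or_isConj_toPSL A with hA | ⟨w, -, hA⟩
  · exact hf.eq_zero_of_isOfFinOrder hA
  · rw [← hf.map_isConj hA, hf.map_toPSL_eq_zero hlyndon]

theorem existsUnique_eq_finsum_mas_smul (hX : IsHalfSystem X) (hf : IsCommutingAdditive f) :
    ∃! m : X → M, ∀ A, f A = ∑ᶠ P : X, mas P A • m P := by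
  have hfin : ∀ Q : X, {P : X | (P : Word).length < (Q : Word).length}.Finite := fun Q =>
    (List.finite_length_lt Bool (Q : Word).length).preimage Subtype.val_injective.injOn
  obtain ⟨m, hm, huniq⟩ := existsUnique_finsum_smul_eq (a := fun Q P : X => mas P (toPSL Q))
    (InvImage.wf (fun P : X => (P : Word).length) wellFounded_lt) hfin
    (fun P => hX.mas_self P.2)
    (fun P Q hne hlen => hX.mas_eq_zero_of_ne P.2 Q.2 (Subtype.coe_ne_coe.mpr hne) (not_lt.mp hlen))
    fun Q => f (toPSL Q)
  refine ⟨m, fun A => ?_, fun m' hm' => huniq m' fun Q => (hm' (toPSL Q)).symm⟩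
  have hdiff := hf.sub (hX.isCommutingAdditive_finsum_mas_smul m)
  refine sub_eq_zero.mp (hX.eq_zero_of_forall_map_toPSL_eq_zero hdiff (fun Q hQ => ?_) A)
  exact sub_eq_zero.mpr (hm ⟨Q, hQ⟩).symm

theorem linearIndependent_masReal (hX : IsHalfSystem X) :
    LinearIndependent ℝ fun P : X => masReal P := by
  rw [linearIndependent_iff]
  intro c hc
  have hzero : IsCommutingAdditive (0 : PSLZ → ℝ) := .of_mem_PX (PX PSLZ).zero_mem
  refine DFunLike.coe_injective <| (hX.existsUnique_eq_finsum_mas_smul hzero).unique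
    (fun A => ?_) fun A => by simp
  rw [← hc, Finsupp.linearCombination_apply, Finsupp.sum, Finset.sum_apply,
    finsum_eq_sum_of_support_subset (s := c.support) _ fun P hP => ?_]
  · exact Finset.sum_congr rfl fun P _ => by simp [masReal, mul_comm]
  · simpa using right_ne_zero_of_smul hP

end IsHalfSystem

end HalfSystem

end ModularWord

theorem mainTheorem9_general {M : Type*} [AddCommGroup M] [IsAddTorsionFree M]
    (Pplus Pminus : Set ModularWord.Word)
    (hdisj : Disjoint Pplus Pminus)
    (hunion : Pplus ∪ Pminus = ModularWord.lyndonWords \ ModularWord.symmetricLyndonWords)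
    (hbij : Set.BijOn ModularWord.lyndonTranspose Pplus Pminus) :
    (∀ P, ModularWord.masReal P ∈ ModularWord.PX ModularWord.PSLZ) ∧
    LinearIndependent ℝ (fun P : Pplus => ModularWord.masReal (P : ModularWord.Word)) ∧
    (∀ A : ModularWord.PSLZ, {P ∈ ModularWord.lyndonWords | ModularWord.mas P A ≠ 0}.Finite) ∧
    ∀ f : ModularWord.PSLZ → M, ModularWord.IsCommutingAdditive f → ∃! m : Pplus → M,
      ∀ A : ModularWord.PSLZ, f A = ∑ᶠ P : Pplus, ModularWord.mas P A • m P := by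
  have hX := ModularWord.isHalfSystem_of_partition hdisj hunion hbij
  exact ⟨ModularWord.masReal_mem_PX, hX.linearIndependent_masReal,
    ModularWord.finite_setOf_mas_ne_zero, fun f hf => hX.existsUnique_eq_finsum_mas_smul hf⟩

theorem mainTheorem9 (Pplus Pminus : Set ModularWord.Word)
    (hdisj : Disjoint Pplus Pminus)
    (hunion : Pplus ∪ Pminus = ModularWord.lyndonWords \ ModularWord.symmetricLyndonWords)
    (hbij : Set.BijOn ModularWord.lyndonTranspose Pplus Pminus) :
    (∀ P ∈ Pplus, ModularWord.masReal P ∈ ModularWord.PX ModularWord.PSLZ) ∧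
    LinearIndependent ℝ (fun P : Pplus => ModularWord.masReal (P : ModularWord.Word)) ∧
    (∀ A : ModularWord.PSLZ, {P ∈ Pplus | ModularWord.masReal P A ≠ 0}.Finite) ∧
    ∀ f ∈ ModularWord.PX ModularWord.PSLZ, ∃! m : Pplus → ℝ,
      ∀ A : ModularWord.PSLZ, f A = ∑ᶠ P : Pplus, m P * ModularWord.masReal P A := by
  obtain ⟨hmem, hind, hfin, hexp⟩ := mainTheorem9_general (M := ℝ) Pplus Pminus hdisj hunion hbij
  refine ⟨fun P _ => hmem P, hind, fun A => (hfin A).subset fun P hP =>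
    ⟨(hunion.subset (Or.inl hP.1)).1, Int.cast_ne_zero.mp hP.2⟩, fun f hf => ?_⟩
  simpa only [zsmul_eq_mul, mul_comm, ModularWord.masReal] using
    hexp f (ModularWord.IsCommutingAdditive.of_mem_PX hf)
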